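/- Let $(K,v)$ be a Henselian valued field (of arbitrary rank, written additively), i.e. $v$ extends uniquely to an algebraic closure $\overline K$ of $K$; the extension is still denoted by $v$. For a finite subextension $L/K$ of $\overline K/K$ write $Lv$ for the residue field, $e(L/K)=(vL:vK)$ and $f(L/K)=[Lv:Kv]$. An element $\theta\in\overline K$ is *tame* over $K$ if $L=K(\theta)$ is separable over $K$, defectless (that is, $[L:K]=e(L/K)f(L/K)$), $Lv/Kv$ is separable, and $\operatorname{char}(Kv)\nmid e(L/K)$. Write $\deg_K\beta=[K(\beta):K]$. Let $\theta\in\overline K$, $n=\deg_K\theta$, and let $F$ be the minimal polynomial of $\theta$ over $K$. A (classical) *Okutsu sequence* of $\theta$ is a list $[\alpha_0,\dots,\alpha_{r-1},\alpha_r=\theta]$ in $\overline K$ whose degrees $m_i=\deg_K\alpha_i$ satisfy $1=m_0<m_1<\cdots<m_r=n$ and such that, for all $0\le i<r$, * $v(\theta-\beta)\le v(\theta-\alpha_i)$ for all $\beta\in\overline K$ with $\deg_K\beta<m_{i+1}$; * $v(\theta-\alpha_i)<v(\theta-\alpha_{i+1})$. **Theorem.** Suppose that $\theta$ is tame over $K$,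 let $[\alpha_0,\dots,\alpha_{r-1},\theta]$ be an Okutsu sequence of $\theta$, and put $\delta_i=v(\theta-\alpha_i)$ for $0\le i<r$. Then $m_i\mid n$ for all $0\le i\le r$, $\delta_0<\cdots<\delta_{r-1}$, and the following two multisets of cardinality $n-1$ coincide: $$\{\,v(\theta-\theta')\mid \theta'\text{ a root of }F\text{ in }\overline K,\ \theta'\ne\theta\,\}=\{\delta_0^{t_0},\dots,\delta_{r-1}^{t_{r-1}}\},\qquad t_i=\frac{n}{m_i}-\frac{n}{m_{i+1}},$$ where the right-hand side is the multiset in which each $\delta_i$ occurs with multiplicity $t_i$. -/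

import Mathlib

open Polynomial IntermediateField

noncomputable section

namespace OkutsuTame

section SingleField

variable {E Γ : Type*} [Field E] [AddCommGroup Γ] [LinearOrder Γ] [IsOrderedAddMonoid Γ]

/-- The valuation ring `{x | 0 ≤ v x}` of an (additively written) valuation. -/
abbrev valRing (v : AddValuation E (WithTop Γ)) : ValuationSubring E :=
  v.toValuation.valuationSubring

/-- The value group `v(L^*)` of a subfield `L` of `E`, as a subgroup of `Γ`. -/
def valGroup (v : AddValuation E (WithTop Γ)) (L : Subfield E) : AddSubgroup Γ where
  carrier := {γ | ∃ x ∈ L, v x = (γ : WithTop Γ)}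
  zero_mem' := ⟨1, L.one_mem, by simp⟩
  add_mem' := by
    rintro a b ⟨x, hx, hxa⟩ ⟨y, hy, hyb⟩
    exact ⟨x * y, L.mul_mem hx hy, by rw [v.map_mul, hxa, hyb, WithTop.coe_add]⟩
  neg_mem' := by
    rintro a ⟨x, hx, hxa⟩
    refine ⟨x⁻¹, L.inv_mem hx, ?_⟩
    have hx0 : x ≠ 0 := by
      rintro rfl
      rw [v.map_zero] at hxa
      exact WithTop.top_ne_coe hxa
    have h1 : v x⁻¹ + v x = 0 := by rw [← v.map_mul, inv_mul_cancel₀ hx0, v.map_one]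
    rw [hxa] at h1
    cases h : v x⁻¹ with
    | top => rw [h] at h1; simp at h1
    | coe c =>
      rw [h, ← WithTop.coe_add, ← WithTop.coe_zero, WithTop.coe_inj] at h1
      rw [eq_neg_of_add_eq_zero_left h1]

/-- The residue field `Lv` of a subfield `L` of `E`, identified with its canonical image in the
residue field of `(E, v)`: it consists of the residue classes of the elements of `L` of
non-negative value. -/
def resField (v : AddValuation E (WithTop Γ)) (L : Subfield E) :
    Subfield (IsLocalRing.ResidueField (valRing v)) where
  carrier := {c | ∃ a : valRing v, (a : E) ∈ L ∧ IsLocalRing.residue (valRing v) a = c}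
  one_mem' := ⟨1, L.one_mem, map_one _⟩
  zero_mem' := ⟨0, L.zero_mem, map_zero _⟩
  mul_mem' := by
    rintro _ _ ⟨a, ha, rfl⟩ ⟨b, hb, rfl⟩
    exact ⟨a * b, L.mul_mem ha hb, map_mul _ _ _⟩
  add_mem' := by
    rintro _ _ ⟨a, ha, rfl⟩ ⟨b, hb, rfl⟩
    exact ⟨a + b, L.add_mem ha hb, map_add _ _ _⟩
  neg_mem' := by
    rintro _ ⟨a, ha, rfl⟩
    exact ⟨-a, L.neg_mem ha, map_neg _ _⟩
  inv_mem' := by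
    rintro _ ⟨a, ha, rfl⟩
    by_cases hu : IsUnit a
    · obtain ⟨u, rfl⟩ := hu
      have hval : (((u⁻¹ : (valRing v)ˣ) : valRing v) : E) = ((u : valRing v) : E)⁻¹ := by
        refine eq_inv_of_mul_eq_one_left ?_
        rw [← MulMemClass.coe_mul, Units.inv_mul, OneMemClass.coe_one]
      refine ⟨((u⁻¹ : (valRing v)ˣ) : valRing v), ?_, ?_⟩
      · rw [hval]
        exact L.inv_mem ha
      · refine eq_inv_of_mul_eq_one_left ?_
        rw [← map_mul, Units.inv_mul, map_one]
    · have h0 : IsLocalRing.residue (valRing v) a = 0 := by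
        rw [IsLocalRing.residue_eq_zero_iff]
        exact hu
      exact ⟨0, L.zero_mem, by rw [h0, map_zero, inv_zero]⟩

end SingleField

section Extension

variable {K Kbar Γ : Type*} [Field K] [Field Kbar] [Algebra K Kbar]
  [AddCommGroup Γ] [LinearOrder Γ] [IsOrderedAddMonoid Γ]

variable (Kbar) in
/-- The valued field `(K, v)` is Henselian: `v` has a unique extension to the algebraic closure
`Kbar` of `K`. Extensions of `v` (up to equivalence of valuations) are given by their valuation
rings: the valuation rings of `Kbar` lying over the valuation ring of `v`. -/
def IsHenselian (v : AddValuation K (WithTop Γ)) : Prop :=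
  ∀ B C : ValuationSubring Kbar,
    B.comap (algebraMap K Kbar) = valRing v → C.comap (algebraMap K Kbar) = valRing v → B = C

/-- The ramification index `e(L/K) = (vL : vK)`. -/
def ramificationIndex (v : AddValuation Kbar (WithTop Γ)) (L : IntermediateField K Kbar) : ℕ :=
  (valGroup v (⊥ : IntermediateField K Kbar).toSubfield).relIndex (valGroup v L.toSubfield)

/-- The inertia degree `f(L/K) = [Lv : Kv]`. -/
def inertiaDegree (v : AddValuation Kbar (WithTop Γ)) (L : IntermediateField K Kbar) : ℕ :=
  (resField v (⊥ : IntermediateField K Kbar).toSubfield).relfinrank (resField v L.toSubfield)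

/-- A finite extension `L/K` is defectless if `[L : K] = e(L/K) f(L/K)`, that is,
its defect `[L : K] / (e(L/K) f(L/K))` is one. -/
def IsDefectless (v : AddValuation Kbar (WithTop Γ)) (L : IntermediateField K Kbar) : Prop :=
  Module.finrank K L = ramificationIndex v L * inertiaDegree v L

/-- Tameness of a finite extension `L/K` (as a subextension of `Kbar/K`). -/
structure IsTame (v : AddValuation Kbar (WithTop Γ)) (L : IntermediateField K Kbar) : Prop where
  finiteDimensional : FiniteDimensional K L
  separable : Algebra.IsSeparable K L
  defectless : IsDefectless v L
  residue_separable : ∀ c ∈ resField v L.toSubfield,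
    IsSeparable (resField v (⊥ : IntermediateField K Kbar).toSubfield) c
  not_dvd : ¬ ringChar (resField v (⊥ : IntermediateField K Kbar).toSubfield) ∣
    ramificationIndex v L

variable (K) in
/-- `V_m(θ)`: the set of all values `v(θ - β)` with `β` of degree less than `m` over `K`. -/
def distanceSet (v : AddValuation Kbar (WithTop Γ)) (θ : Kbar) (m : ℕ) : Set (WithTop Γ) :=
  {ρ | ∃ β : Kbar, (minpoly K β).natDegree < m ∧ v (θ - β) = ρ}

variable (K) in
/-- `[A 0, …, A (r-1), A r = {θ}]` is an Okutsu sequence of `θ` over `K`, where `m i` is the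
common degree over `K` of the elements of `A i`. -/
structure IsOkutsuSequence (v : AddValuation Kbar (WithTop Γ)) (θ : Kbar) {r : ℕ}
    (A : Fin (r + 1) → Set Kbar) (m : Fin (r + 1) → ℕ) : Prop where
  last : A (Fin.last r) = {θ}
  degree : ∀ i, ∀ α ∈ A i, (minpoly K α).natDegree = m i
  degree_zero : m 0 = 1
  degree_strictMono : StrictMono m
  os0 : ∀ i : Fin r, ∀ β : Kbar, (minpoly K β).natDegree < m i.succ →
    ∃ α ∈ A i.castSucc, v (θ - β) ≤ v (θ - α)
  os1 : ∀ i : Fin r, (∃ ρ, IsGreatest (distanceSet K v θ (m i.succ)) ρ) →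
    ∃ α, A i.castSucc = {α}
  os2 : ∀ i : Fin r, (¬ ∃ ρ, IsGreatest (distanceSet K v θ (m i.succ)) ρ) →
    ∀ α ∈ A i.castSucc, ∀ α' ∈ A i.castSucc, α ≠ α' →
      v (θ - α) < v (θ - α') ∨ v (θ - α') < v (θ - α)
  os3 : ∀ i : Fin r, ∀ α ∈ A i.castSucc, ∀ γ ∈ A i.succ, v (θ - α) < v (θ - γ)

end Extension

end OkutsuTame

end

/-! Partition the conjugates of `θ` into closed balls of radius `γ`, and let `N(γ)` be the number of
balls. The Henselian property makes `v` Galois invariant, so the Galois group permutes the balls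
transitively and each of them has `n / N(γ)` elements. The theorem amounts to `N(δ_i) = m_i`,
together with the absence of further distances between conjugates.

If `γ ≤ v (θ - β)`, the conjugates of `β` come close to every ball, so `N(γ) ≤ deg β`
(`card_conjBalls_le_natDegree`). Tameness shows that the bound is attained
(`exists_natDegree_le_card_conjBalls`): some integral `a = p(θ)` in `K(θ)` has trace of value `0`,
and the average of the ball around `θ` with weights `p(y)` lies in this ball and has at most `N(γ)`
conjugates. Hence `N(γ)` is the least degree of an element at distance at least `γ`, which is what
an Okutsu sequence records.

The element `a` comes from `exists_val_trace_eq_zero`. Defectlessness provides a basis of products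
`x i * y j`, with values of the `x i` distinct modulo `vK` and residues of the `y j` a basis of
`Lv/Kv`. So the trace of `a` reduces to `e` times the residue trace of `a`. The latter can be chosen
to be `1` by separability, and `e` is nonzero in `Kv`. -/

namespace OkutsuTame

/-! ### Value-independent products and the reduction of the trace -/

section ValueIndependence

variable {K E Γ : Type*} [Field K] [Field E] [Algebra K E]
  [AddCommGroup Γ] [LinearOrder Γ] [IsOrderedAddMonoid Γ]

theorem mul_lt_mul_val_iff (v : AddValuation E (WithTop Γ)) {x y z : E} (hz : z ≠ 0) :
    v (z * x) < v (z * y) ↔ v x < v y := by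
  rw [v.map_mul, v.map_mul]
  exact WithTop.add_lt_add_iff_left (v.ne_top_iff.2 hz)

theorem mul_le_mul_val_iff (v : AddValuation E (WithTop Γ)) {x y z : E} (hz : z ≠ 0) :
    v (z * x) ≤ v (z * y) ↔ v x ≤ v y := by
  simpa only [not_lt] using not_congr (mul_lt_mul_val_iff v hz (x := y) (y := x))

theorem div_val_nonneg_iff (v : AddValuation E (WithTop Γ)) {x y : E} (hy : y ≠ 0) :
    0 ≤ v (x / y) ↔ v y ≤ v x := by
  rw [← v.map_one, ← mul_le_mul_val_iff v hy, mul_one, mul_div_cancel₀ _ hy]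

theorem div_val_pos_iff (v : AddValuation E (WithTop Γ)) {x y : E} (hy : y ≠ 0) :
    0 < v (x / y) ↔ v y < v x := by
  rw [← v.map_one, ← mul_lt_mul_val_iff v hy, mul_one, mul_div_cancel₀ _ hy]

/-- If the nonzero terms of a sum have pairwise distinct values, then no term has a smaller value
than the sum. -/
theorem lt_val_of_lt_val_sum {ι : Type*} [Fintype ι] (v : AddValuation E (WithTop Γ)) (z : ι → E)
    (hz : ∀ i i', z i ≠ 0 → z i' ≠ 0 → v (z i) = v (z i') → i = i')
    {γ : WithTop Γ} (hγ : γ < v (∑ i, z i)) (i : ι) : γ < v (z i) := by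
  classical
  by_contra! hi
  -- A term of least value strictly dominates all others, so the sum has this value, which is at
  -- most `γ`.
  obtain ⟨k, hk, hmin⟩ := Finset.exists_min_image (Finset.univ.filter fun i => v (z i) ≤ γ)
    (fun i => v (z i)) ⟨i, by simpa using hi⟩
  simp only [Finset.mem_filter, Finset.mem_univ, true_and] at hk hmin
  have hktop : v (z k) ≠ ⊤ := ((hk.trans_lt hγ).trans_le le_top).ne
  have hk0 : z k ≠ 0 := v.ne_top_iff.1 hktop
  have hlt : ∀ j, j ≠ k → v (z k) < v (z j) := by
    intro j hj
    by_cases hj0 : z j = 0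
    · rw [hj0, v.map_zero]
      exact lt_top_iff_ne_top.2 hktop
    · rcases le_or_gt (v (z j)) γ with h | h
      · exact lt_of_le_of_ne (hmin j h) fun h' => hj (hz k j hk0 hj0 h').symm
      · exact hk.trans_lt h
  have h1 : v (z k) < v (∑ j ∈ Finset.univ.erase k, z j) :=
    v.map_lt_sum hktop fun j hj => hlt j (Finset.ne_of_mem_erase hj)
  have h2 := v.map_add_eq_of_lt_left h1
  rw [Finset.add_sum_erase _ _ (Finset.mem_univ k)] at h2
  exact (hγ.trans_eq h2).not_ge hk

/-- If the residues of the `y j` are linearly independent, then the value of a nontrivial linear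
combination of the `y j` is at most, and equal to some one, of the values of the coefficients. -/
theorem val_combination_le {κ : Type*} [Fintype κ] (v : AddValuation E (WithTop Γ)) (y : κ → E)
    (hy0 : ∀ j, 0 ≤ v (y j))
    (hy : ∀ c : κ → K, (∀ j, 0 ≤ v (algebraMap K E (c j))) →
      0 < v (∑ j, algebraMap K E (c j) * y j) → ∀ j, 0 < v (algebraMap K E (c j)))
    (c : κ → K) (hc : c ≠ 0) :
    ∃ k, c k ≠ 0 ∧ v (∑ j, algebraMap K E (c j) * y j) = v (algebraMap K E (c k)) ∧
      ∀ j, v (algebraMap K E (c k)) ≤ v (algebraMap K E (c j)) := by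
  obtain ⟨j₀, hj₀⟩ := Function.ne_iff.1 hc
  obtain ⟨k, -, hmin⟩ := Finset.exists_min_image Finset.univ
    (fun j => v (algebraMap K E (c j))) ⟨j₀, Finset.mem_univ _⟩
  replace hmin := fun j => hmin j (Finset.mem_univ j)
  have hk : c k ≠ 0 := by
    intro h
    have := hmin j₀
    rw [h, _root_.map_zero, v.map_zero, top_le_iff, v.top_iff] at this
    exact hj₀ ((map_eq_zero _).1 this)
  have hk' : algebraMap K E (c k) ≠ 0 := by simpa using hk
  refine ⟨k, hk, le_antisymm ?_ ?_, hmin⟩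
  · by_contra! h
    refine lt_irrefl (0 : WithTop Γ) ?_
    -- After division by `c k` all coefficients are integral and the `k`-th is `1`, whose value is
    -- not positive.
    have := hy (fun j => c j / c k) (fun j => ?_) ?_ k
    · rwa [div_self hk, map_one, v.map_one] at this
    · rw [map_div₀, div_val_nonneg_iff v hk']
      exact hmin j
    · rw [← div_val_pos_iff v hk', Finset.sum_div] at h
      convert h using 3
      rw [map_div₀, div_mul_eq_mul_div]
  · refine v.map_le_sum fun j _ => ?_
    rw [v.map_mul]
    exact (hmin j).trans (le_add_of_nonneg_right (hy0 j))

/-- Grouping by `i`, each nonzero inner sum over `j` has the value of one of its coefficients. The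
grouped terms then have distinct values by `hx`, so no cancellation occurs either within or between
groups. -/
theorem lt_val_of_lt_val_combination {ι κ : Type*} [Fintype ι] [Fintype κ]
    (v : AddValuation E (WithTop Γ)) (x : ι → E) (y : κ → E)
    (hx : ∀ i i' (c c' : K), c ≠ 0 → c' ≠ 0 →
      v (algebraMap K E c * x i) = v (algebraMap K E c' * x i') → i = i')
    (hy0 : ∀ j, 0 ≤ v (y j))
    (hy : ∀ c : κ → K, (∀ j, 0 ≤ v (algebraMap K E (c j))) →
      0 < v (∑ j, algebraMap K E (c j) * y j) → ∀ j, 0 < v (algebraMap K E (c j)))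
    (c : ι × κ → K) {γ : WithTop Γ} (hγt : γ ≠ ⊤)
    (hγ : γ < v (∑ p, algebraMap K E (c p) * (x p.1 * y p.2))) (i : ι) (j : κ) :
    γ < v (algebraMap K E (c (i, j)) * x i) := by
  by_cases hci : (fun j => c (i, j)) = 0
  · have : c (i, j) = 0 := congrFun hci j
    rw [this, _root_.map_zero, zero_mul, v.map_zero]
    exact lt_top_iff_ne_top.2 hγt
  have hsum : ∑ p, algebraMap K E (c p) * (x p.1 * y p.2) =
      ∑ i, (∑ j, algebraMap K E (c (i, j)) * y j) * x i := by
    rw [Fintype.sum_prod_type]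
    refine Finset.sum_congr rfl fun i _ => ?_
    rw [Finset.sum_mul]
    exact Finset.sum_congr rfl fun j _ => by ring
  rw [hsum] at hγ
  have key := lt_val_of_lt_val_sum v _ ?_ hγ i
  · obtain ⟨k, -, hk, hmin⟩ := val_combination_le v y hy0 hy _ hci
    rw [v.map_mul, hk] at key
    rw [v.map_mul]
    exact key.trans_le (add_le_add_left (hmin j) _)
  · intro i i' hi hi' h
    have aux : ∀ i, (∑ j, algebraMap K E (c (i, j)) * y j) * x i ≠ 0 →
        ∃ k, c (i, k) ≠ 0 ∧ v ((∑ j, algebraMap K E (c (i, j)) * y j) * x i) =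
          v (algebraMap K E (c (i, k)) * x i) := by
      intro i hi
      obtain ⟨k, hk0, hk, -⟩ := val_combination_le v y hy0 hy (fun j => c (i, j)) (by
        rintro h0
        refine hi ?_
        rw [Finset.sum_eq_zero, zero_mul]
        intro j _
        rw [show c (i, j) = 0 from congrFun h0 j, _root_.map_zero, zero_mul])
      exact ⟨k, hk0, by rw [v.map_mul, hk, ← v.map_mul]⟩
    obtain ⟨k, hk, hk'⟩ := aux i hi
    obtain ⟨k', hkk, hkk'⟩ := aux i' hi'
    exact hx i i' _ _ hk hkk (by rw [← hk', ← hkk', h])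

/-- The trace of an integral element `a` over a basis `x i * y j` of products, where the values of
the `x i` are independent modulo the value group of `K` and the residues of the `y j` are linearly
independent: if `M` represents multiplication by `a` on the residues of the `y j`, then
the trace of `a` is congruent to `card ι` times the trace of `M`. -/
theorem val_trace_sub_pos {ι κ : Type*} [Fintype ι] [Fintype κ]
    (v : AddValuation E (WithTop Γ)) (L : IntermediateField K E)
    (b : Module.Basis (ι × κ) K L) (x : ι → E) (y : κ → E)
    (hb : ∀ p, (b p : E) = x p.1 * y p.2) (hx0 : ∀ i, x i ≠ 0)
    (hx : ∀ i i' (c c' : K), c ≠ 0 → c' ≠ 0 →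
      v (algebraMap K E c * x i) = v (algebraMap K E c' * x i') → i = i')
    (hy0 : ∀ j, 0 ≤ v (y j))
    (hy : ∀ c : κ → K, (∀ j, 0 ≤ v (algebraMap K E (c j))) →
      0 < v (∑ j, algebraMap K E (c j) * y j) → ∀ j, 0 < v (algebraMap K E (c j)))
    (a : L) (M : Matrix κ κ K)
    (hM : ∀ j, 0 < v (a * y j - ∑ k, algebraMap K E (M k j) * y k)) :
    0 < v (algebraMap K E (Algebra.trace K L a - Fintype.card ι * M.trace)) := by
  classical
  have hexp : ∀ z : L, (z : E) = ∑ p, algebraMap K E (b.repr z p) * (x p.1 * y p.2) := by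
    intro z
    conv_lhs => rw [← b.sum_repr z]
    rw [IntermediateField.coe_sum]
    refine Finset.sum_congr rfl fun p _ => ?_
    rw [IntermediateField.coe_smul, hb, Algebra.smul_def]
  -- Subtracting column `j` of `M` in block `i` leaves the coordinates of `x i * (a * y j - ∑ k, M k
  -- j * y k)`, whose value exceeds `v (x i)`.
  have hdiag : ∀ i j, 0 < v (algebraMap K E (b.repr (a * b (i, j)) (i, j) - M j j)) := by
    intro i j
    have h := lt_val_of_lt_val_combination v x y hx hy0 hy
      (fun p => b.repr (a * b (i, j)) p - if p.1 = i then M p.2 j else 0)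
      (v.ne_top_iff.2 (hx0 i)) ?_ i j
    · simp only [if_true] at h
      rw [mul_comm] at h
      rw [← v.map_one, ← mul_lt_mul_val_iff v (hx0 i), mul_one]
      exact h
    · have : ∑ p : ι × κ, algebraMap K E (b.repr (a * b (i, j)) p - if p.1 = i then M p.2 j else 0) *
          (x p.1 * y p.2) = x i * (a * y j - ∑ k, algebraMap K E (M k j) * y k) := by
        simp only [map_sub, sub_mul, Finset.sum_sub_distrib]
        rw [← hexp, Fintype.sum_prod_type, Finset.sum_eq_single i, mul_sub, Finset.mul_sum]
        · congr 1
          · rw [MulMemClass.coe_mul, hb]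
            ring
          · refine Finset.sum_congr rfl fun k _ => ?_
            rw [if_pos rfl]
            ring
        · intro i' _ hi'
          simp [hi']
        · simp
      rw [this]
      have h := (mul_lt_mul_val_iff v (hx0 i) (x := 1)).2 ((v.map_one).trans_lt (hM j))
      rwa [mul_one] at h
  have : Algebra.trace K L a - Fintype.card ι * M.trace =
      ∑ p : ι × κ, (b.repr (a * b p) p - M p.2 p.2) := by
    rw [Algebra.trace_eq_matrix_trace b, Finset.sum_sub_distrib]
    congr 1
    · simp [Matrix.trace, Algebra.leftMulMatrix_eq_repr_mul]
    · rw [Fintype.sum_prod_type]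
      simp [Matrix.trace]
  rw [this, map_sum]
  exact v.map_lt_sum WithTop.zero_ne_top fun p _ => hdiag p.1 p.2

end ValueIndependence

/-! ### Tame extensions have an integral element with unit trace -/

section UnitTrace

variable {K E Γ : Type*} [Field K] [Field E] [Algebra K E]
  [AddCommGroup Γ] [LinearOrder Γ] [IsOrderedAddMonoid Γ]

theorem residue_eq_zero_iff_val_pos (v : AddValuation E (WithTop Γ)) (x : valRing v) :
    IsLocalRing.residue _ x = 0 ↔ 0 < v x := by
  rw [IsLocalRing.residue_eq_zero_iff]
  exact Valuation.mem_maximalIdeal_iff _ _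

theorem mem_bot_toSubfield_iff {x : E} :
    x ∈ (⊥ : IntermediateField K E).toSubfield ↔ ∃ c, algebraMap K E c = x :=
  IntermediateField.mem_bot

theorem resField_mono (v : AddValuation E (WithTop Γ)) {L L' : Subfield E} (h : L ≤ L') :
    resField v L ≤ resField v L' := by
  rintro _ ⟨a, ha, rfl⟩
  exact ⟨a, h ha, rfl⟩

theorem bot_toSubfield_le (L : IntermediateField K E) :
    (⊥ : IntermediateField K E).toSubfield ≤ L.toSubfield :=
  fun _ hx => (bot_le : (⊥ : IntermediateField K E) ≤ L) hx

/-- Representatives for the values of `L` modulo the values of `K`. -/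
theorem exists_value_representatives (v : AddValuation E (WithTop Γ)) (L : IntermediateField K E)
    (he : ramificationIndex v L ≠ 0) :
    ∃ x : Fin (ramificationIndex v L) → E, (∀ i, x i ∈ L) ∧ (∀ i, x i ≠ 0) ∧
      ∀ i i' (c c' : K), c ≠ 0 → c' ≠ 0 →
        v (algebraMap K E c * x i) = v (algebraMap K E c' * x i') → i = i' := by
  set H := (valGroup v (⊥ : IntermediateField K E).toSubfield).addSubgroupOf
    (valGroup v L.toSubfield) with hH
  have hcard : Nat.card (_ ⧸ H) = ramificationIndex v L := rfl
  have : Finite (_ ⧸ H) := Nat.finite_of_card_ne_zero (hcard ▸ he)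
  let e : Fin (ramificationIndex v L) ≃ _ ⧸ H := (Finite.equivFinOfCardEq hcard).symm
  choose x hxL hx using fun i => (e i).out.2
  have hx0 : ∀ i, x i ≠ 0 := fun i => v.ne_top_iff.1 (by rw [hx]; exact WithTop.coe_ne_top)
  refine ⟨x, hxL, hx0, fun i i' c c' hc hc' h => e.injective ?_⟩
  rw [← QuotientAddGroup.out_eq' (e i), ← QuotientAddGroup.out_eq' (e i'), QuotientAddGroup.eq]
  refine AddSubgroup.mem_addSubgroupOf.2
    ⟨algebraMap K E (c / c'), mem_bot_toSubfield_iff.2 ⟨_, rfl⟩, ?_⟩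
  have hc0 : algebraMap K E c' ≠ 0 := by simpa using hc'
  have h1 : algebraMap K E (c / c') * x i * algebraMap K E c' = algebraMap K E c * x i := by
    rw [map_div₀]
    field_simp
  have h2 : v (algebraMap K E (c / c') * x i) = v (x i') := by
    have := congrArg v h1
    rw [h, v.map_mul, v.map_mul (algebraMap K E c'), add_comm] at this
    exact (WithTop.add_left_inj (v.ne_top_iff.2 hc0)).1 this
  rw [v.map_mul, hx, hx] at h2
  cases hcc : v (algebraMap K E (c / c')) with
  | top => rw [hcc] at h2; simp at h2
  | coe g =>
    rw [hcc, ← WithTop.coe_add, WithTop.coe_inj] at h2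
    rw [WithTop.coe_inj]
    push_cast
    rw [← h2]
    abel

theorem val_natCast_eq_zero (v : AddValuation E (WithTop Γ)) (k : Subfield E) {e : ℕ}
    (he : ¬ ringChar (resField v k) ∣ e) : v (e : E) = 0 := by
  have h0 : 0 ≤ v (e : E) := ((e : valRing v)).2
  refine le_antisymm (not_lt.1 fun h => he ((ringChar.spec _ _).1 (Subtype.ext ?_))) h0
  have h1 := (residue_eq_zero_iff_val_pos v (e : valRing v)).2 h
  rw [map_natCast] at h1
  exact (map_natCast (resField v k).subtype e).trans h1

/-- Representatives for a basis of the residue field of `L`, together with an integral element `a`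
whose residue has trace one. -/
theorem exists_residue_representatives (v : AddValuation E (WithTop Γ)) (L : IntermediateField K E)
    (hf : inertiaDegree v L ≠ 0)
    (hsep : ∀ c ∈ resField v L.toSubfield,
      IsSeparable (resField v (⊥ : IntermediateField K E).toSubfield) c) :
    ∃ y : Fin (inertiaDegree v L) → E, (∀ j, y j ∈ L) ∧ (∀ j, 0 ≤ v (y j)) ∧
      (∀ c : Fin (inertiaDegree v L) → K, (∀ j, 0 ≤ v (algebraMap K E (c j))) →
        0 < v (∑ j, algebraMap K E (c j) * y j) → ∀ j, 0 < v (algebraMap K E (c j))) ∧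
      ∃ a ∈ L, 0 ≤ v a ∧ ∃ M : Matrix (Fin (inertiaDegree v L)) (Fin (inertiaDegree v L)) K,
        (∀ j, 0 < v (a * y j - ∑ l, algebraMap K E (M l j) * y l)) ∧
        0 < v (algebraMap K E (M.trace - 1)) := by
  classical
  set k := resField v (⊥ : IntermediateField K E).toSubfield with hk
  have hle : k ≤ resField v L.toSubfield := resField_mono v (bot_toSubfield_le L)
  let F := Subfield.extendScalars hle
  have hF : Module.finrank k F = inertiaDegree v L :=
    (Subfield.relfinrank_eq_finrank_of_le hle).symm
  -- An infinite extension would have `finrank` zero.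
  have : FiniteDimensional k F := Module.finite_of_finrank_pos (by omega)
  have : Algebra.IsSeparable k F := ⟨fun c => by
    have := hsep c.1 c.2
    rw [IsSeparable] at this ⊢
    rwa [IntermediateField.minpoly_eq]⟩
  have hrep : ∀ c : F, ∃ a : valRing v, (a : E) ∈ L ∧
      IsLocalRing.residue (valRing v) a = (c : IsLocalRing.ResidueField (valRing v)) := fun c => c.2
  have hrep0 : ∀ c : k, ∃ a : K, ∃ ha : 0 ≤ v (algebraMap K E a),
      IsLocalRing.residue (valRing v) ⟨algebraMap K E a, ha⟩ =
        (c : IsLocalRing.ResidueField (valRing v)) := by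
    rintro ⟨_, a, ha, rfl⟩
    obtain ⟨c, hc⟩ := mem_bot_toSubfield_iff.1 ha
    exact ⟨c, by rw [hc]; exact a.2, by congr 1; exact Subtype.ext hc⟩
  choose lift hlift hliftres using hrep
  choose lift0 hlift0 hlift0res using hrep0
  let B := Module.finBasisOfFinrankEq k F hF
  -- The trace form of a finite separable extension is nonzero. The matrix `M` lifts, entry by
  -- entry, the matrix `N` of multiplication by `ab`.
  obtain ⟨ab, hab⟩ := Algebra.trace_surjective k F 1
  let N := Algebra.leftMulMatrix B ab
  refine ⟨fun j => lift (B j), fun j => hlift _, fun j => (lift (B j)).2, ?_,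
    lift ab, hlift ab, (lift ab).2, fun j j' => lift0 (N j j'), ?_, ?_⟩
  · intro c hc h j
    let c' : Fin (inertiaDegree v L) → valRing v := fun j => ⟨algebraMap K E (c j), hc j⟩
    let cb : Fin (inertiaDegree v L) → k := fun j =>
      ⟨IsLocalRing.residue _ (c' j), c' j, mem_bot_toSubfield_iff.2 ⟨_, rfl⟩, rfl⟩
    have h1 : IsLocalRing.residue (valRing v) (∑ j, c' j * lift (B j)) = 0 := by
      rw [residue_eq_zero_iff_val_pos]
      convert h
      push_cast
      rfl
    have h2 : ∑ j, cb j • B j = 0 := by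
      apply Subtype.ext
      rw [map_sum] at h1
      simp only [map_mul, hliftres] at h1
      rw [IntermediateField.coe_sum]
      exact h1
    have h3 := Fintype.linearIndependent_iff.1 B.linearIndependent cb h2 j
    exact (residue_eq_zero_iff_val_pos v (c' j)).1 (congrArg Subtype.val h3)
  · intro j
    have h1 : IsLocalRing.residue (valRing v) (lift ab * lift (B j) -
        ∑ l, (⟨algebraMap K E (lift0 (N l j)), hlift0 _⟩ : valRing v) * lift (B l)) = 0 := by
      rw [map_sub, map_sum, sub_eq_zero]
      simp only [map_mul, hliftres]
      have h2 : ab * B j = ∑ l, N l j • B l := by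
        simp only [N, Algebra.leftMulMatrix_eq_repr_mul]
        rw [B.sum_repr]
      have h3 := congrArg Subtype.val h2
      rw [IntermediateField.coe_sum] at h3
      refine Eq.trans h3 (Finset.sum_congr rfl fun l _ => ?_)
      rw [hlift0res]
      rfl
    rw [residue_eq_zero_iff_val_pos] at h1
    convert h1
    push_cast
    rfl
  · have h1 : ∑ j, N j j = 1 := by
      rw [← hab, Algebra.trace_eq_matrix_trace B]
      rfl
    have h2 : IsLocalRing.residue (valRing v)
        (∑ j, (⟨algebraMap K E (lift0 (N j j)), hlift0 _⟩ : valRing v) - 1) = 0 := by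
      rw [map_sub, map_sum, map_one, sub_eq_zero]
      simp only [hlift0res]
      have := congrArg Subtype.val h1
      rw [AddSubmonoidClass.coe_finsetSum] at this
      exact this
    rw [residue_eq_zero_iff_val_pos] at h2
    convert h2
    simp only [Matrix.trace, Matrix.diag, map_sub, _root_.map_one, map_sum]
    push_cast
    rfl

/-- All tameness conditions meet here: the trace of `a` is congruent to `e`, a unit of the valuation
ring. -/
theorem exists_val_trace_eq_zero (v : AddValuation E (WithTop Γ)) (L : IntermediateField K E)
    (hL : IsTame v L) :
    ∃ a : L, 0 ≤ v a ∧ v (algebraMap K E (Algebra.trace K L a)) = 0 := by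
  classical
  obtain ⟨hfin, -, hdef, hsep, hchar⟩ := hL
  -- Both factors would be `0` in the infinite case; the defect formula excludes this.
  have hn : ramificationIndex v L * inertiaDegree v L ≠ 0 :=
    hdef ▸ Module.finrank_pos.ne'
  obtain ⟨he, hf⟩ := mul_ne_zero_iff.1 hn
  obtain ⟨x, hxL, hx0, hx⟩ := exists_value_representatives v L he
  obtain ⟨y, hyL, hy0, hy, a, haL, ha, M, hM, hMtr⟩ := exists_residue_representatives v L hf hsep
  let w : Fin (ramificationIndex v L) × Fin (inertiaDegree v L) → L :=
    fun p => ⟨x p.1 * y p.2, L.mul_mem (hxL _) (hyL _)⟩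
  have hw : LinearIndependent K w := by
    rw [Fintype.linearIndependent_iff]
    rintro g hg ⟨i, j⟩
    by_contra hgij
    have h0 : ∑ p, algebraMap K E (g p) * (x p.1 * y p.2) = 0 := by
      have := congrArg (Subtype.val : L → E) hg
      rw [IntermediateField.coe_sum] at this
      simp only [IntermediateField.coe_smul] at this
      simp only [Algebra.smul_def] at this
      exact this
    have hne : algebraMap K E (g (i, j)) * x i ≠ 0 := mul_ne_zero (by simpa using hgij) (hx0 i)
    have htop := v.ne_top_iff.2 hne
    -- A vanishing sum has value `⊤`, so the term at `(i, j)` would have value greater than itself.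
    refine lt_irrefl _ (lt_val_of_lt_val_combination v x y hx hy0 hy g htop ?_ i j)
    rw [h0, v.map_zero]
    exact lt_top_iff_ne_top.2 htop
  have : Nonempty (Fin (ramificationIndex v L) × Fin (inertiaDegree v L)) :=
    ⟨⟨0, Nat.pos_of_ne_zero he⟩, ⟨0, Nat.pos_of_ne_zero hf⟩⟩
  let b := basisOfLinearIndependentOfCardEqFinrank hw (by simpa using hdef.symm)
  have hb : ∀ p, (b p : E) = x p.1 * y p.2 := fun p => by
    simp only [b, coe_basisOfLinearIndependentOfCardEqFinrank, w]
  refine ⟨⟨a, haL⟩, ha, ?_⟩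
  have htr := val_trace_sub_pos v L b x y hb hx0 hx hy0 hy ⟨a, haL⟩ M hM
  rw [Fintype.card_fin] at htr
  have hev : v (algebraMap K E (ramificationIndex v L)) = 0 := by
    rw [map_natCast]
    exact val_natCast_eq_zero v _ hchar
  have h : 0 < v (algebraMap K E (Algebra.trace K L ⟨a, haL⟩) -
      algebraMap K E (ramificationIndex v L)) := by
    have hmul : 0 < v (algebraMap K E (ramificationIndex v L * (M.trace - 1))) := by
      rwa [_root_.map_mul, v.map_mul, hev, zero_add]
    convert v.map_lt_add htr hmul using 2
    simp only [map_sub, _root_.map_mul, _root_.map_one]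
    ring
  rw [← hev] at h
  rw [v.map_eq_of_lt_sub h, hev]

end UnitTrace

/-! ### Galois invariance of the valuation -/

section Henselian

variable {K Kbar Γ : Type*} [Field K] [Field Kbar] [Algebra K Kbar] [IsAlgClosure K Kbar]
  [AddCommGroup Γ] [LinearOrder Γ] [IsOrderedAddMonoid Γ]

/-- The extension of a Henselian valuation to the algebraic closure is Galois invariant. -/
theorem val_algEquiv {vK : AddValuation K (WithTop Γ)} (hK : IsHenselian Kbar vK)
    {v : AddValuation Kbar (WithTop Γ)} (hv : v.comap (algebraMap K Kbar) = vK)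
    (σ : Kbar ≃ₐ[K] Kbar) (x : Kbar) : v (σ x) = v x := by
  have : Algebra.IsAlgebraic K Kbar := IsAlgClosure.isAlgebraic
  have hnonneg : ∀ (σ : Kbar ≃ₐ[K] Kbar) (x : Kbar), 0 ≤ v (σ x) ↔ 0 ≤ v x := by
    intro σ x
    have h := hK ((valRing v).comap (σ : Kbar →+* Kbar)) (valRing v) ?_ ?_
    · exact (SetLike.ext_iff.1 h x :)
    · ext c
      rw [← hv]
      change 0 ≤ v (σ (algebraMap K Kbar c)) ↔ 0 ≤ v (algebraMap K Kbar c)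
      rw [σ.commutes]
    · rw [← hv]
      rfl
  -- Otherwise the values of `σ ^ k x` increase strictly with `k`, giving infinitely many conjugates
  -- of `x`. Comparisons of values pass through `σ ^ k` because integrality of quotients does.
  have hlt : ∀ (σ : Kbar ≃ₐ[K] Kbar) (x : Kbar), ¬ v x < v (σ x) := by
    intro σ x hx
    have hiter : ∀ k : ℕ, v ((σ ^ k) x) < v ((σ ^ (k + 1)) x) := by
      intro k
      rw [pow_succ, AlgEquiv.mul_apply, ← not_le]
      intro hle
      by_cases h0 : σ x = 0
      · simp only [map_eq_zero_iff σ σ.injective] at h0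
        rw [h0, _root_.map_zero σ] at hx
        exact lt_irrefl _ hx
      · have h1 : (σ ^ k) (σ x) ≠ 0 := by rwa [Ne, map_eq_zero_iff _ (σ ^ k).injective]
        rw [← div_val_nonneg_iff v h1, ← map_div₀, hnonneg,
          div_val_nonneg_iff v h0] at hle
        exact hx.not_ge hle
    have hinj : Function.Injective fun k : ℕ => (σ ^ k) x := by
      intro a b hab
      exact (strictMono_nat_of_lt_succ hiter).injective (congrArg v hab)
    have hx0 : minpoly K x ≠ 0 := minpoly.ne_zero (Algebra.IsIntegral.isIntegral x)
    refine Set.infinite_range_of_injective hinj (((minpoly K x).rootSet_finite Kbar).subset ?_)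
    rintro _ ⟨k, rfl⟩
    rw [mem_rootSet_of_ne hx0]
    change aeval ((σ ^ k) x) (minpoly K x) = 0
    rw [aeval_algHom_apply, minpoly.aeval, _root_.map_zero]
  refine le_antisymm (not_lt.1 (hlt σ x)) (not_lt.1 fun h => hlt σ.symm (σ x) ?_)
  rwa [σ.symm_apply_apply]

end Henselian

/-! ### Balls of conjugates and degrees -/

noncomputable section Conjugates

variable {K Kbar Γ : Type*} [Field K] [Field Kbar] [Algebra K Kbar]
  [AddCommGroup Γ] [LinearOrder Γ] [IsOrderedAddMonoid Γ]

theorem card_aroots_minpoly [IsAlgClosure K Kbar] (θ : Kbar) :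
    Multiset.card ((minpoly K θ).aroots Kbar) = (minpoly K θ).natDegree := by
  have := IsAlgClosure.isAlgClosed K (K := Kbar)
  rw [← (IsAlgClosed.splits ((minpoly K θ).map (algebraMap K Kbar))).natDegree_eq_card_roots,
    natDegree_map]

theorem nodup_aroots_minpoly {θ : Kbar} (hθ : IsSeparable K θ) :
    ((minpoly K θ).aroots Kbar).Nodup :=
  nodup_roots (Separable.map hθ)

variable [DecidableEq Kbar]

variable (K) in
/-- The finite set of conjugates of `θ` over `K`. -/
def conjugates (θ : Kbar) : Finset Kbar := ((minpoly K θ).aroots Kbar).toFinset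

variable (K) in
/-- The conjugates `y` of `θ` lying in the closed ball `γ ≤ v (x - y)`. -/
def conjBall (v : AddValuation Kbar (WithTop Γ)) (θ : Kbar) (γ : WithTop Γ) (x : Kbar) :
    Finset Kbar :=
  (conjugates K θ).filter fun y => γ ≤ v (x - y)

variable (K) in
/-- The partition of the conjugates of `θ` into closed balls of radius `γ`. -/
def conjBalls (v : AddValuation Kbar (WithTop Γ)) (θ : Kbar) (γ : WithTop Γ) :
    Finset (Finset Kbar) :=
  (conjugates K θ).image (conjBall K v θ γ)

theorem card_conjugates_le (θ : Kbar) : (conjugates K θ).card ≤ (minpoly K θ).natDegree := by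
  refine (Multiset.toFinset_card_le _).trans ((card_roots' _).trans ?_)
  rw [natDegree_map]

section Balls

variable {v : AddValuation Kbar (WithTop Γ)} {θ : Kbar} {γ : WithTop Γ}

theorem mem_conjBall_iff {x y : Kbar} :
    y ∈ conjBall K v θ γ x ↔ y ∈ conjugates K θ ∧ γ ≤ v (x - y) := by
  rw [conjBall, Finset.mem_filter]

theorem self_mem_conjBall {x : Kbar} (hx : x ∈ conjugates K θ) : x ∈ conjBall K v θ γ x :=
  mem_conjBall_iff.2 ⟨hx, by simp⟩

theorem conjBall_eq_of_le {x y : Kbar} (h : γ ≤ v (x - y)) :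
    conjBall K v θ γ x = conjBall K v θ γ y := by
  ext z
  simp only [mem_conjBall_iff]
  refine and_congr_right fun _ => ⟨fun hz => ?_, fun hz => ?_⟩
  · rw [show y - z = (x - z) - (x - y) by ring]
    exact v.map_le_sub hz h
  · rw [show x - z = (x - y) + (y - z) by ring]
    exact v.map_le_add h hz

theorem filter_conjBall_eq (x : Kbar) :
    (conjugates K θ).filter (fun y => conjBall K v θ γ y = conjBall K v θ γ x) =
      conjBall K v θ γ x := by
  ext y
  rw [Finset.mem_filter, mem_conjBall_iff]
  refine and_congr_right fun hy => ⟨fun h => ?_, fun h => (conjBall_eq_of_le h).symm⟩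
  have := self_mem_conjBall (v := v) (γ := γ) hy
  rw [h] at this
  exact (mem_conjBall_iff.1 this).2

variable (v γ) in
theorem sum_conjBalls {M : Type*} [AddCommMonoid M] (g : Kbar → M) :
    ∑ b ∈ conjBalls K v θ γ, ∑ y ∈ b, g y = ∑ y ∈ conjugates K θ, g y := by
  rw [← Finset.sum_fiberwise_of_maps_to (s := conjugates K θ) (t := conjBalls K v θ γ)
    (g := conjBall K v θ γ) fun y hy => Finset.mem_image_of_mem _ hy]
  refine Finset.sum_congr rfl fun b hb => ?_
  obtain ⟨x, -, rfl⟩ := Finset.mem_image.1 hb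
  rw [filter_conjBall_eq]

end Balls

variable [IsAlgClosure K Kbar]

theorem card_conjugates {θ : Kbar} (hθ : IsSeparable K θ) :
    (conjugates K θ).card = (minpoly K θ).natDegree := by
  rw [conjugates, Multiset.toFinset_card_of_nodup (nodup_aroots_minpoly hθ), card_aroots_minpoly]

theorem mem_conjugates_iff {θ y : Kbar} :
    y ∈ conjugates K θ ↔ ∃ σ : Kbar ≃ₐ[K] Kbar, σ θ = y := by
  have : Algebra.IsAlgebraic K Kbar := IsAlgClosure.isAlgebraic
  have : Normal K Kbar := IsAlgClosure.normal K Kbar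
  have h0 : minpoly K θ ≠ 0 := minpoly.ne_zero (Algebra.IsIntegral.isIntegral θ)
  rw [conjugates, Multiset.mem_toFinset, mem_aroots, and_iff_right h0]
  constructor
  · exact minpoly.exists_algEquiv_of_root' (Algebra.IsAlgebraic.isAlgebraic θ)
  · rintro ⟨σ, rfl⟩
    rw [← AlgEquiv.coe_toAlgHom, aeval_algHom_apply, minpoly.aeval, _root_.map_zero]

theorem self_mem_conjugates (θ : Kbar) : θ ∈ conjugates K θ :=
  mem_conjugates_iff.2 ⟨1, rfl⟩

theorem map_mem_conjugates_iff {θ y : Kbar} (σ : Kbar ≃ₐ[K] Kbar) :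
    σ y ∈ conjugates K θ ↔ y ∈ conjugates K θ := by
  simp only [mem_conjugates_iff]
  constructor
  · rintro ⟨τ, hτ⟩
    exact ⟨τ.trans σ.symm, by simp [hτ]⟩
  · rintro ⟨τ, rfl⟩
    exact ⟨τ.trans σ, rfl⟩

theorem algebraMap_trace_adjoin_eq_sum {θ : Kbar} [Algebra.IsSeparable K K⟮θ⟯]
    [FiniteDimensional K K⟮θ⟯] (p : K[X]) :
    algebraMap K Kbar (Algebra.trace K K⟮θ⟯ (aeval (AdjoinSimple.gen K θ) p)) =
      ∑ y ∈ conjugates K θ, aeval y p := by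
  have := IsAlgClosure.isAlgClosed K (K := Kbar)
  have : Algebra.IsAlgebraic K Kbar := IsAlgClosure.isAlgebraic
  rw [trace_eq_sum_embeddings Kbar]
  refine Finset.sum_nbij (fun φ => φ (AdjoinSimple.gen K θ)) ?_ ?_ ?_ ?_
  · intro φ _
    rw [conjugates, Multiset.mem_toFinset, mem_aroots]
    refine ⟨minpoly.ne_zero (Algebra.IsIntegral.isIntegral θ), ?_⟩
    rw [aeval_algHom_apply, ← minpoly_gen K θ, minpoly.aeval, _root_.map_zero]
  · intro φ _ ψ _ h
    exact (adjoin.powerBasis (Algebra.IsIntegral.isIntegral θ)).algHom_ext h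
  · intro y hy
    obtain ⟨σ, rfl⟩ := mem_conjugates_iff.1 (Finset.mem_coe.1 hy)
    exact ⟨(σ : Kbar →ₐ[K] Kbar).comp (K⟮θ⟯).val, by simp, by simp⟩
  · intro φ _
    rw [aeval_algHom_apply]

variable {v : AddValuation Kbar (WithTop Γ)} {θ : Kbar} {γ : WithTop Γ}

theorem image_conjBall (hG : ∀ (σ : Kbar ≃ₐ[K] Kbar) x, v (σ x) = v x)
    (σ : Kbar ≃ₐ[K] Kbar) (x : Kbar) :
    (conjBall K v θ γ x).image σ = conjBall K v θ γ (σ x) := by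
  ext z
  obtain ⟨y, rfl⟩ := σ.surjective z
  rw [σ.injective.mem_finset_image, mem_conjBall_iff, mem_conjBall_iff, map_mem_conjugates_iff,
    ← map_sub, hG]

theorem sum_conjBall_map (hG : ∀ (σ : Kbar ≃ₐ[K] Kbar) x, v (σ x) = v x)
    (σ : Kbar ≃ₐ[K] Kbar) (x : Kbar) (p : K[X]) :
    ∑ y ∈ conjBall K v θ γ (σ x), aeval y p = σ (∑ y ∈ conjBall K v θ γ x, aeval y p) := by
  rw [← image_conjBall hG, Finset.sum_image σ.injective.injOn, map_sum]
  exact Finset.sum_congr rfl fun y _ => aeval_algHom_apply (σ : Kbar →ₐ[K] Kbar) y p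

theorem mem_conjBalls_iff {b : Finset Kbar} :
    b ∈ conjBalls K v θ γ ↔ ∃ σ : Kbar ≃ₐ[K] Kbar, conjBall K v θ γ (σ θ) = b := by
  simp only [conjBalls, Finset.mem_image, mem_conjugates_iff]
  constructor
  · rintro ⟨_, ⟨σ, rfl⟩, rfl⟩
    exact ⟨σ, rfl⟩
  · rintro ⟨σ, rfl⟩
    exact ⟨_, ⟨σ, rfl⟩, rfl⟩

variable (θ γ) in
/-- All balls in the partition of the conjugates have the same number of elements. -/
theorem card_conjBalls_mul_card_conjBall (hG : ∀ (σ : Kbar ≃ₐ[K] Kbar) x, v (σ x) = v x) :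
    (conjBalls K v θ γ).card * (conjBall K v θ γ θ).card = (conjugates K θ).card := by
  rw [Finset.card_eq_sum_ones (conjugates K θ), ← sum_conjBalls v γ, ← smul_eq_mul,
    ← Finset.sum_const]
  refine Finset.sum_congr rfl fun b hb => ?_
  obtain ⟨σ, rfl⟩ := mem_conjBalls_iff.1 hb
  rw [← Finset.card_eq_sum_ones, ← image_conjBall hG, Finset.card_image_of_injective _ σ.injective]

/-- An element in the ball of radius `γ` around `θ` has degree at least the number of balls of
radius `γ` in the set of conjugates of `θ`. -/
theorem card_conjBalls_le_natDegree (hG : ∀ (σ : Kbar ≃ₐ[K] Kbar) x, v (σ x) = v x)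
    {β : Kbar} (hβ : γ ≤ v (θ - β)) :
    (conjBalls K v θ γ).card ≤ (minpoly K β).natDegree := by
  have hsub : conjBalls K v θ γ ⊆ (conjugates K β).image (conjBall K v θ γ) := by
    intro b hb
    obtain ⟨σ, rfl⟩ := mem_conjBalls_iff.1 hb
    refine Finset.mem_image.2 ⟨σ β, mem_conjugates_iff.2 ⟨σ, rfl⟩, (conjBall_eq_of_le ?_).symm⟩
    rwa [← map_sub, hG]
  exact (Finset.card_le_card hsub).trans (Finset.card_image_le.trans (card_conjugates_le β))

/-- If `θ` is tame, every ball around `θ` contains an element whose degree is at most the number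
of balls of this radius in the set of conjugates of `θ`. -/
theorem exists_natDegree_le_card_conjBalls
    (hG : ∀ (σ : Kbar ≃ₐ[K] Kbar) x, v (σ x) = v x) (hθ : IsTame v K⟮θ⟯) (γ : WithTop Γ) :
    ∃ β : Kbar, γ ≤ v (θ - β) ∧ (minpoly K β).natDegree ≤ (conjBalls K v θ γ).card := by
  have : Algebra.IsAlgebraic K Kbar := IsAlgClosure.isAlgebraic
  have := hθ.finiteDimensional
  have := hθ.separable
  have hsep : IsSeparable K θ := by
    have := Algebra.IsSeparable.isSeparable K (AdjoinSimple.gen K θ)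
    rwa [IsSeparable, minpoly_gen] at this
  obtain ⟨a, ha, htr⟩ := exists_val_trace_eq_zero v K⟮θ⟯ hθ
  obtain ⟨p, -, rfl⟩ :=
    (adjoin.powerBasis (Algebra.IsIntegral.isIntegral (R := K) θ)).exists_eq_aeval a
  rw [adjoin.powerBasis_gen] at ha htr
  rw [algebraMap_trace_adjoin_eq_sum] at htr
  have hp : ∀ y ∈ conjugates K θ, 0 ≤ v (aeval y p) := by
    intro y hy
    obtain ⟨σ, rfl⟩ := mem_conjugates_iff.1 hy
    have h1 : aeval (σ θ) p = σ (aeval θ p) := aeval_algHom_apply (σ : Kbar →ₐ[K] Kbar) θ p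
    rw [h1, hG]
    convert ha using 2
    exact aeval_algHom_apply (K⟮θ⟯).val (AdjoinSimple.gen K θ) p
  let den : Finset Kbar → Kbar := fun b => ∑ y ∈ b, aeval y p
  let num : Finset Kbar → Kbar := fun b => ∑ y ∈ b, aeval y (p * X)
  set T := conjBall K v θ γ θ with hT
  have hTsub : ∀ y ∈ T, y ∈ conjugates K θ := fun y hy => (mem_conjBall_iff.1 hy).1
  have hmap : ∀ (q : K[X]) (σ : Kbar ≃ₐ[K] Kbar),
      ∑ y ∈ conjBall K v θ γ (σ θ), aeval y q = σ (∑ y ∈ T, aeval y q) :=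
    fun q σ => sum_conjBall_map hG σ θ q
  have hden : v (den T) = 0 := by
    -- The sums `den b` over the balls are Galois conjugate, hence of equal value, and add up to the
    -- trace, of value `0`; so none has positive value.
    refine le_antisymm (not_lt.1 fun h => ?_) (v.map_le_sum fun y hy => hp y (hTsub y hy))
    refine lt_irrefl (0 : WithTop Γ) ?_
    rw [← sum_conjBalls v γ] at htr
    refine lt_of_lt_of_eq (v.map_lt_sum WithTop.zero_ne_top fun b hb => ?_) htr
    obtain ⟨σ, rfl⟩ := mem_conjBalls_iff.1 hb
    rwa [hmap, hG]
  have hden0 : den T ≠ 0 := v.ne_top_iff.1 (hden ▸ WithTop.zero_ne_top)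
  refine ⟨num T / den T, ?_, ?_⟩
  · have h1 : den T * (θ - num T / den T) = ∑ y ∈ T, aeval y p * (θ - y) := by
      rw [mul_sub, mul_div_cancel₀ _ hden0, Finset.sum_mul, ← Finset.sum_sub_distrib]
      refine Finset.sum_congr rfl fun y _ => ?_
      rw [_root_.map_mul, aeval_X]
      ring
    have h2 : v (θ - num T / den T) = v (∑ y ∈ T, aeval y p * (θ - y)) := by
      rw [← h1, v.map_mul, hden, zero_add]
    rw [h2]
    refine v.map_le_sum fun y hy => ?_
    rw [v.map_mul]
    exact (mem_conjBall_iff.1 hy).2.trans (le_add_of_nonneg_left (hp y (hTsub y hy)))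
  · have hsum : ∀ q : K[X], ∑ y ∈ T, aeval y q ∈ separableClosure K Kbar := by
      refine fun q => sum_mem fun y hy => ?_
      have hy' : y ∈ separableClosure K Kbar := by
        obtain ⟨σ, rfl⟩ := mem_conjugates_iff.1 (hTsub y hy)
        rw [mem_separableClosure_iff, IsSeparable, minpoly.algEquiv_eq]
        exact hsep
      have := IntermediateField.aeval_coe (separableClosure K Kbar)
        (⟨y, hy'⟩ : separableClosure K Kbar) q
      exact this ▸ SetLike.coe_mem _
    -- Separability is needed for the degree to equal the number of distinct conjugates.
    have hβ : IsSeparable K (num T / den T) :=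
      mem_separableClosure_iff.1 (div_mem (hsum _) (hsum _))
    rw [← card_conjugates hβ]
    -- The conjugate by `σ` depends only on the ball of `σ θ`.
    have hsub : conjugates K (num T / den T) ⊆
        (conjBalls K v θ γ).image fun b => num b / den b := by
      intro z hz
      obtain ⟨σ, rfl⟩ := mem_conjugates_iff.1 hz
      refine Finset.mem_image.2 ⟨_, mem_conjBalls_iff.2 ⟨σ, rfl⟩, ?_⟩
      simp only [num, den, hmap, map_div₀]
    exact (Finset.card_le_card hsub).trans Finset.card_image_le

end Conjugates

/-! ### Okutsu sequences count balls -/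

section OkutsuSequence

variable {K Kbar Γ : Type*} [Field K] [Field Kbar] [Algebra K Kbar]
  [AddCommGroup Γ] [LinearOrder Γ] [IsOrderedAddMonoid Γ]
  {v : AddValuation Kbar (WithTop Γ)} {θ : Kbar}
  {r : ℕ} {α : Fin (r + 1) → Kbar} {m : Fin (r + 1) → ℕ}

theorem IsOkutsuSequence.strictMono_val
    (hα : IsOkutsuSequence K v θ (fun i => {α i}) m) : StrictMono fun i => v (θ - α i) :=
  Fin.strictMono_iff_lt_succ.2 fun i => hα.os3 i _ rfl _ rfl

theorem IsOkutsuSequence.val_le (hα : IsOkutsuSequence K v θ (fun i => {α i}) m) (i : Fin r)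
    {β : Kbar} (hβ : (minpoly K β).natDegree < m i.succ) : v (θ - β) ≤ v (θ - α i.castSucc) := by
  obtain ⟨_, rfl, h⟩ := hα.os0 i β hβ
  exact h

theorem IsOkutsuSequence.apply_last (hα : IsOkutsuSequence K v θ (fun i => {α i}) m) :
    α (Fin.last r) = θ :=
  Set.singleton_injective hα.last

variable [IsAlgClosure K Kbar] [DecidableEq Kbar]

/-- The element `α i` itself bounds the count by `m i`. With fewer balls, some `β` of degree below
`m i` would be as close to `θ` as `α i`, against the maximality of the preceding term. -/
theorem IsOkutsuSequence.card_conjBalls (hα : IsOkutsuSequence K v θ (fun i => {α i}) m)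
    (hG : ∀ (σ : Kbar ≃ₐ[K] Kbar) x, v (σ x) = v x) (hθ : IsTame v K⟮θ⟯) (i : Fin (r + 1)) :
    (conjBalls K v θ (v (θ - α i))).card = m i := by
  have : Algebra.IsAlgebraic K Kbar := IsAlgClosure.isAlgebraic
  have hle := card_conjBalls_le_natDegree hG (le_refl (v (θ - α i)))
  rw [hα.degree i _ rfl] at hle
  refine le_antisymm hle (not_lt.1 fun hlt => ?_)
  obtain ⟨β, hβ, hdeg⟩ := exists_natDegree_le_card_conjBalls hG hθ (v (θ - α i))
  have hβm := hdeg.trans_lt hlt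
  cases i using Fin.cases with
  | zero =>
    have := minpoly.natDegree_pos (Algebra.IsIntegral.isIntegral (R := K) β)
    rw [hα.degree_zero] at hβm
    omega
  | succ j =>
    exact ((hβ.trans (hα.val_le j hβm)).trans_lt (hα.os3 j _ rfl _ rfl)).false

/-- A distance strictly between consecutive values would already force at least `m j.succ` balls,
whereas the ball at the next value omits `y` and is smaller. This contradicts (number of balls) ×
(size) = `n` for both radii. -/
theorem IsOkutsuSequence.exists_val_sub_eq (hα : IsOkutsuSequence K v θ (fun i => {α i}) m)
    (hG : ∀ (σ : Kbar ≃ₐ[K] Kbar) x, v (σ x) = v x) (hθ : IsTame v K⟮θ⟯) {y : Kbar}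
    (hy : y ∈ conjugates K θ) : ∃ i, v (θ - y) = v (θ - α i) := by
  have hpos : ∀ γ, 0 < (conjBall K v θ γ θ).card := fun γ =>
    Finset.card_pos.2 ⟨θ, self_mem_conjBall (self_mem_conjugates θ)⟩
  -- As `m 0 = 1`, a single ball of this radius contains all conjugates.
  have h0 : v (θ - α 0) ≤ v (θ - y) := by
    have h1 := card_conjBalls_mul_card_conjBall θ (v (θ - α 0)) hG
    rw [hα.card_conjBalls hG hθ, hα.degree_zero, one_mul] at h1
    have h2 := Finset.eq_of_subset_of_card_le (Finset.filter_subset _ _) h1.ge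
    exact (mem_conjBall_iff.1 ((Finset.ext_iff.1 h2 y).2 hy)).2
  obtain ⟨i, hi, hmax⟩ := Finset.exists_max_image
    (Finset.univ.filter fun i => v (θ - α i) ≤ v (θ - y)) id ⟨0, by simpa using h0⟩
  simp only [Finset.mem_filter, Finset.mem_univ, true_and, id] at hi hmax
  refine ⟨i, le_antisymm (not_lt.1 fun hlt => ?_) hi⟩
  cases i using Fin.lastCases with
  | last =>
    rw [hα.apply_last, sub_self, v.map_zero] at hlt
    exact not_top_lt hlt
  | cast j =>
    have hj : v (θ - y) < v (θ - α j.succ) :=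
      not_le.1 fun h => (hmax _ h).not_gt (Fin.castSucc_lt_succ (i := j))
    obtain ⟨β, hβ, hdeg⟩ := exists_natDegree_le_card_conjBalls hG hθ (v (θ - y))
    have hm : m j.succ ≤ (conjBalls K v θ (v (θ - y))).card :=
      (not_lt.1 fun h => ((hβ.trans (hα.val_le j h)).trans_lt hlt).false).trans hdeg
    rw [← hα.card_conjBalls hG hθ] at hm
    have hss : conjBall K v θ (v (θ - α j.succ)) θ ⊂ conjBall K v θ (v (θ - y)) θ := by
      refine Finset.ssubset_iff_of_subset (fun z hz => ?_) |>.2 ⟨y, ?_, ?_⟩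
      · rw [mem_conjBall_iff] at hz ⊢
        exact ⟨hz.1, hj.le.trans hz.2⟩
      · exact mem_conjBall_iff.2 ⟨hy, le_rfl⟩
      · exact fun h => hj.not_ge (mem_conjBall_iff.1 h).2
    have hcard := Finset.card_lt_card hss
    have e1 := card_conjBalls_mul_card_conjBall θ (v (θ - α j.succ)) hG
    have e2 := card_conjBalls_mul_card_conjBall θ (v (θ - y)) hG
    have hpos' : 0 < (conjBalls K v θ (v (θ - y))).card := by
      refine Nat.pos_of_ne_zero fun h => ?_
      rw [h, zero_mul] at e2
      exact (Finset.card_pos.2 ⟨θ, self_mem_conjugates θ⟩).ne e2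
    exact (Nat.mul_lt_mul_of_le_of_lt hm hcard hpos').ne (e1.trans e2.symm)

end OkutsuSequence

end OkutsuTame

/-! ### Counting conjugates by distance -/

theorem theorem4p5 {K Kbar Γ : Type*} [Field K] [Field Kbar] [Algebra K Kbar]
    [IsAlgClosure K Kbar] [AddCommGroup Γ] [LinearOrder Γ] [IsOrderedAddMonoid Γ]
    [DecidableEq Kbar]
    (vK : AddValuation K (WithTop Γ)) (hK : OkutsuTame.IsHenselian Kbar vK)
    (v : AddValuation Kbar (WithTop Γ)) (hv : v.comap (algebraMap K Kbar) = vK)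
    (θ : Kbar) (hθ : OkutsuTame.IsTame v K⟮θ⟯)
    (n : ℕ) (hn : n = (minpoly K θ).natDegree)
    (r : ℕ) (α : Fin (r + 1) → Kbar) (m : Fin (r + 1) → ℕ)
    (hα : OkutsuTame.IsOkutsuSequence K v θ (fun i => {α i}) m)
    (δ : Fin r → WithTop Γ) (hδ : ∀ i, δ i = v (θ - α i.castSucc))
    (t : Fin r → ℕ) (ht : ∀ i, t i = n / m i.castSucc - n / m i.succ) :
    (∀ i, m i ∣ n) ∧ StrictMono δ ∧
    Multiset.card ((((minpoly K θ).aroots Kbar).filter (fun θ' => θ' ≠ θ)).map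
      (fun θ' => v (θ - θ'))) = n - 1 ∧
    (((minpoly K θ).aroots Kbar).filter (fun θ' => θ' ≠ θ)).map (fun θ' => v (θ - θ')) =
      ∑ i : Fin r, Multiset.replicate (t i) (δ i) := by
  open OkutsuTame in
  have hG := val_algEquiv hK hv
  have hsep : IsSeparable K θ := by
    have := hθ.separable
    have := Algebra.IsSeparable.isSeparable K (AdjoinSimple.gen K θ)
    rwa [IsSeparable, minpoly_gen] at this
  have hcard : (conjugates K θ).card = n := by rw [card_conjugates hsep, hn]
  have hmul : ∀ i, m i * (conjBall K v θ (v (θ - α i)) θ).card = n := fun i => by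
    rw [← hα.card_conjBalls hG hθ, card_conjBalls_mul_card_conjBall θ _ hG, hcard]
  have hn0 : 0 < n := hcard ▸ Finset.card_pos.2 ⟨θ, self_mem_conjugates θ⟩
  have hball : ∀ i, (conjBall K v θ (v (θ - α i)) θ).card = n / m i := fun i =>
    (Nat.div_eq_of_eq_mul_right (Nat.pos_of_mul_pos_right (hn0.trans_eq (hmul i).symm))
      (hmul i).symm).symm
  have hmono := hα.strictMono_val
  have hδ' : StrictMono δ := by
    rw [show δ = fun i => v (θ - α i.castSucc) from funext hδ]
    exact hmono.comp Fin.strictMono_castSucc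
  have hset : ((minpoly K θ).aroots Kbar).filter (fun θ' => θ' ≠ θ) =
      ((conjugates K θ).erase θ).val := by
    rw [Finset.erase_val, conjugates, Multiset.toFinset_val,
      (nodup_aroots_minpoly hsep).dedup, (nodup_aroots_minpoly hsep).erase_eq_filter]
  refine ⟨fun i => ⟨_, (hmul i).symm⟩, hδ', ?_, ?_⟩
  · rw [Multiset.card_map, hset, Finset.card_val, Finset.card_erase_of_mem (self_mem_conjugates θ),
      hcard]
  · classical
    ext ρ
    rw [hset, Multiset.count_map, Multiset.count_sum']
    simp only [Multiset.count_replicate]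
    change (((conjugates K θ).erase θ).filter fun y => ρ = v (θ - y)).card = _
    by_cases hρ : ∃ i, δ i = ρ
    · obtain ⟨i, rfl⟩ := hρ
      simp only [hδ'.injective.eq_iff, Finset.sum_ite_eq', Finset.mem_univ, if_true]
      -- Conjugates at distance exactly `δ i` form the difference of two concentric balls. For the
      -- last `i` the inner radius is `⊤` and the inner ball is `{θ}`.
      rw [ht, ← hball, ← hball, ← Finset.card_sdiff_of_subset]
      · congr 1
        ext y
        rw [Finset.mem_filter, Finset.mem_erase, Finset.mem_sdiff, mem_conjBall_iff,
          mem_conjBall_iff, hδ]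
        constructor
        · rintro ⟨⟨-, hy⟩, h⟩
          exact ⟨⟨hy, h.le⟩, fun h' =>
            (hmono (Fin.castSucc_lt_succ (i := i))).not_ge (h'.2.trans h.ge)⟩
        · rintro ⟨⟨hy, h⟩, h'⟩
          refine ⟨⟨?_, hy⟩, ?_⟩
          · rintro rfl
            exact h' ⟨hy, by simp⟩
          · obtain ⟨l, hl⟩ := hα.exists_val_sub_eq hG hθ hy
            rw [hl] at h h' ⊢
            have h1 : i.castSucc ≤ l := hmono.le_iff_le.1 h
            have h2 : l < i.succ := hmono.lt_iff_lt.1 (not_le.1 fun h => h' ⟨hy, h⟩)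
            rw [le_antisymm h1 (Fin.le_castSucc_iff.2 h2)]
      · intro y hy
        rw [mem_conjBall_iff] at hy ⊢
        exact ⟨hy.1, (hmono (Fin.castSucc_lt_succ (i := i))).le.trans hy.2⟩
    · push Not at hρ
      rw [Finset.sum_eq_zero fun i _ => if_neg (hρ i), Finset.card_eq_zero,
        Finset.filter_eq_empty_iff]
      rintro y hy rfl
      obtain ⟨hne, hy⟩ := Finset.mem_erase.1 hy
      obtain ⟨l, hl⟩ := hα.exists_val_sub_eq hG hθ hy
      cases l using Fin.lastCases with
      | last =>
        rw [hα.apply_last, sub_self, v.map_zero, v.top_iff, sub_eq_zero] at hl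
        exact hne hl.symm
      | cast j => exact hρ j ((hδ j).trans hl.symm)
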